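/- Let $H=\langle V,E^*\rangle$ be a graph and let $R$ be a property of graphs. An $H$-pregraph is a triple $G=\langle V,E,N\rangle$ with $E\cup N\subseteq E^*$ and $E\cap N=\emptyset$; put $P_G=E\cup N$ (the determined pairs) and $U_G=E^*\setminus P_G$ (the undetermined pairs). An $H$-pregraph $G'$ extends $G$ if $E_G\subseteq E_{G'}$ and $N_G\subseteq N_{G'}$. An $H$-graph is a graph $F=\langle V,E_F\rangle$ with $E_F\subseteq E^*$; it extends $G$ if $E_G\subseteq E_F$ and $N_G\cap E_F=\emptyset$. In the transfinite game $\mathbb E_{H,R}$, Alice and Bob construct a sequence $\langle G_\alpha:\alpha\le\beta\rangle$ of $H$-pregraphs, where $G_0=\langle V,\emptyset,\emptyset\rangle$, and where $E_{G_\alpha}=\bigcup_{\zeta<\alpha}E_{G_\zeta}$ and $N_{G_\alpha}=\bigcup_{\zeta<\alpha}N_{G_\zeta}$ for limit ordinals $\alpha$. The game terminates as soon as it reaches a $G_\beta$ such that either every $H$-graph extending $G_\beta$ has property $R$, or no $H$-graph extending $G_\beta$ has property $R$. If the game has not terminated at $G_\gamma$, then Alice picks a pair $e_\gamma\in U_{G_\gamma}$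 and Bob picks an $H$-pregraph $G_{\gamma+1}$ that extends $G_\gamma$ with $P_{G_{\gamma+1}}=P_{G_\gamma}\cup\{e_\gamma\}$. If the game terminates at $G_\beta$, then Bob wins if $P_{G_\beta}=E^*$, and otherwise Alice wins. The property $R$ is elusive in $H$ if Alice does not have a winning strategy in $\mathbb E_{H,R}$. For a natural number $n\ge 1$ let $D_n$ be the property "every vertex has degree at least $n$", and for a natural number $m\ge 2$ let $C_m$ be the property "every connected component has at least $m$ vertices". For a cardinal $\kappa$ let $K_\kappa$ be the complete graph on $\kappa$ and, for a natural number $k\ge2$, let $T_{\kappa,k}$ be the Turán graph with vertex set $\kappa\times k$ in which $\langle\alpha,i\rangle$ and $\langle\beta,j\rangle$ are adjacent if and only if $i\ne j$. The Cantor graph has as its vertices all finite $0$-$1$ sequences, and $s,t$ are adjacent if and only if $s\subsetneq t$ or $t\subsetneq s$. **Theorem.** Let $P$ be either $D_n$ for some $n\ge 1$ or $C_m$ for some $m\ge 2$. Let $H$ be either the complete graph $K_\kappa$ for some infinite cardinal $\kappa$, or the Turán graph $T_{\kappa,k}$ for some infinite cardinal $\kappa$ and some natural number $k\ge 2$, or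 the Cantor graph. Then Alice has a winning strategy in the game $\mathbb E_{H,P}$, i.e. the property $P$ is not elusive in $H$. -/

import Mathlib

universe u

/-- An `H`-pregraph `⟨V, E, N⟩`: disjoint sets of edges and of nonedges, both consisting of
edges of `H` (the allowed edges). -/
@[ext]
structure Pregraph {V : Type u} (H : SimpleGraph V) where
  edges : Set (Sym2 V)
  nonedges : Set (Sym2 V)
  union_subset : edges ∪ nonedges ⊆ H.edgeSet
  inter_eq_empty : edges ∩ nonedges = ∅

namespace Pregraph

variable {V : Type u} {H : SimpleGraph V}

/-- The set `P` of determined pairs. -/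
def determined (G : Pregraph H) : Set (Sym2 V) := G.edges ∪ G.nonedges

/-- The set `U` of undetermined pairs. -/
def undetermined (G : Pregraph H) : Set (Sym2 V) := H.edgeSet \ G.determined

/-- The pregraph `⟨V, ∅, ∅⟩`. -/
def empty (H : SimpleGraph V) : Pregraph H where
  edges := ∅
  nonedges := ∅
  union_subset := by simp
  inter_eq_empty := by simp

/-- The pregraph `G'` extends the pregraph `G`. -/
def ExtendedBy (G G' : Pregraph H) : Prop :=
  G.edges ⊆ G'.edges ∧ G.nonedges ⊆ G'.nonedges

/-- The graph `F` is an `H`-graph that extends the pregraph `G`. The nonedges of a graph `F` are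
the pairs of distinct vertices that are not edges of `F`, i.e. the edges of its complement. -/
def ExtendedByGraph (G : Pregraph H) (F : SimpleGraph V) : Prop :=
  F ≤ H ∧ G.edges ⊆ F.edgeSet ∧ G.nonedges ⊆ Fᶜ.edgeSet

end Pregraph

/-! ### The transfinite query game on `H` for the property `R` -/

section Game

variable {V : Type u} (H : SimpleGraph V) (R : SimpleGraph V → Prop)

/-- The game terminates at the pregraph `G`: every `H`-graph extending `G` has property `R`,
or no `H`-graph extending `G` has property `R`. -/
def Terminated (G : Pregraph H) : Prop :=
  (∀ F : SimpleGraph V, G.ExtendedByGraph F → R F) ∨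
    (∀ F : SimpleGraph V, G.ExtendedByGraph F → ¬ R F)

/-- One turn: Alice picks the undetermined pair `e` of `G`, and Bob answers by choosing a
pregraph `G'` that extends `G` and determines exactly one more pair, namely `e`. -/
def IsTurn (G : Pregraph H) (e : Sym2 V) (G' : Pregraph H) : Prop :=
  e ∈ G.undetermined ∧ G.ExtendedBy G' ∧ G'.determined = G.determined ∪ {e}

/-- A strategy of Alice assigns a pair to each history `⟨G_α : α ≤ γ⟩`. -/
abbrev AliceStrategy : Type (u + 1) :=
  (γ : Ordinal.{u}) → (Set.Iic γ → Pregraph H) → Sym2 V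

/-- The sequence `⟨G_α : α ≤ β⟩` is an initial segment of a run of the game in which Alice plays
according to the strategy `σ` (the values `G α` for `α > β` are irrelevant). No position before
the last one is terminal; the last one may or may not be. -/
structure IsRunFollowing (σ : AliceStrategy H) (β : Ordinal.{u})
    (G : Ordinal.{u} → Pregraph H) : Prop where
  zero : G 0 = Pregraph.empty H
  limit_edges : ∀ α ≤ β, Order.IsSuccLimit α → (G α).edges = ⋃ ζ < α, (G ζ).edges
  limit_nonedges : ∀ α ≤ β, Order.IsSuccLimit α → (G α).nonedges = ⋃ ζ < α, (G ζ).nonedges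
  not_terminated : ∀ γ < β, ¬ Terminated H R (G γ)
  turn : ∀ γ < β, IsTurn H (G γ) (σ γ (fun α => G α)) (G (Order.succ γ))

/-- `σ` is a winning strategy of Alice: as long as the game has not terminated it picks an
undetermined pair, and whenever a run in which Alice follows `σ` terminates, say at `G_β`, then
Bob does not win, i.e. the determined pairs of `G_β` are not all the edges of `H`.
(The picked pairs are pairwise distinct, so every such run does terminate, at a stage smaller than
the successor cardinal of the number of pairs.) -/
def IsWinningForAlice (σ : AliceStrategy H) : Prop :=
  ∀ (β : Ordinal.{u}) (G : Ordinal.{u} → Pregraph H), IsRunFollowing H R σ β G →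
    (¬ Terminated H R (G β) → σ β (fun α => G α) ∈ (G β).undetermined) ∧
    (Terminated H R (G β) → (G β).determined ≠ H.edgeSet)

/-- Alice has a winning strategy in the game on `H` for the property `R`. -/
def AliceHasWinningStrategy : Prop :=
  ∃ σ : AliceStrategy H, IsWinningForAlice H R σ

/-- The property `R` is elusive in `H`. -/
def IsElusive : Prop := ¬ AliceHasWinningStrategy H R

end Game

/-! ### The graph properties -/

/-- `D_n`: the degree of each vertex is at least `n` (degrees may be infinite). -/
def DegreesAtLeast (n : ℕ) {V : Type u} (G : SimpleGraph V) : Prop :=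
  ∀ v : V, (n : ℕ∞) ≤ (G.neighborSet v).encard

/-- `C_m`: each connected component has at least `m` vertices (components may be infinite). -/
def ComponentsAtLeast (m : ℕ) {V : Type u} (G : SimpleGraph V) : Prop :=
  ∀ c : G.ConnectedComponent, (m : ℕ∞) ≤ c.supp.encard

/-! ### The host graphs -/

/-- The complete graph `K_κ`; its vertices are the ordinals below the cardinal `κ`. -/
def completeGraphCard (κ : Cardinal.{u}) : SimpleGraph κ.ord.ToType := ⊤

/-- The Turán graph `T_{κ,k}` with vertex set `κ × k`. -/
def turanGraphCard (κ : Cardinal.{u}) (k : ℕ) : SimpleGraph (κ.ord.ToType × Fin k) where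
  Adj p q := p.2 ≠ q.2
  symm := ⟨fun _ _ h => h.symm⟩
  loopless := ⟨fun _ h => h rfl⟩

/-- The Cantor graph: the vertices are the finite 0-1 sequences, and two of them are adjacent
iff one is a proper initial segment of the other. -/
def cantorGraph : SimpleGraph (List Bool) where
  Adj s t := s ≠ t ∧ (s <+: t ∨ t <+: s)
  symm := ⟨fun _ _ h => ⟨h.1.symm, h.2.symm⟩⟩
  loopless := ⟨fun _ h => h.1 rfl⟩

/-!
Both `D_n` and `C_m` say that a set attached to each vertex (its neighborhood or its connected
component) has at least a given finite number `t` of elements; call a vertex *large* in a position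
if this is already guaranteed by the edges. Alice wins whenever all degrees of the host graph `H`
are infinite, which is the case for all three kinds of host graphs. The argument uses only the few
common features of neighborhoods and components that are collected in `GrowingNbhd`.

* A pair between two large vertices is irrelevant for the property. If there is such an undetermined
  pair, then Alice asks all the other pairs, and the game terminates no later than that, with this
  pair undetermined (`GrowingNbhd.aliceWinsFrom_of_large_of_large`).
* Infinite degrees help Alice as follows. If she asks infinitely many pairs at a vertex `v` in an
  order without a last element, then Bob has to accept one of them at a stage at which infinitely
  many of them are still undetermined; otherwise `v` can be made to fail for good while a pair
  elsewhere is undetermined. Repeating this finitely often makes `v` large, with infinitely many of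
  the pairs undetermined (`GrowingNbhd.aliceWinsFrom_of_search`).

Alice makes a vertex `v₀` large in this way, and reserves a set `K` of `t + 1` vertices with the
pairs between `v₀` and `K` undetermined. Then she asks all the pairs that do not meet `K`. If all
but finitely many of the vertices outside of `K` are large now, then some `w ∈ K` has infinitely many
large neighbors in `H` to which its pairs are undetermined, and Alice makes `w` large while one of
these pairs remains undetermined; that pair is irrelevant. Otherwise she asks everything except the
pairs between `v₀` and `K`. If some `k ∈ K` becomes large, then the pair of `v₀` and `k` is
irrelevant. If none does, then the vertices of `K` have helped finitely many vertices only, and one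
of the infinitely many remaining ones witnesses that the property fails
(`GrowingNbhd.aliceHasWinningStrategy`).

Strategies are composed by `AliceWinsFrom.of_phase`: Alice follows a positional rule until the first
stage at which some condition holds, and then a strategy for the position reached. The two rules
that are needed are `AliceWinsFrom.of_ask_all` and `AliceWinsFrom.of_ask_until_edge`.
-/

/-! ### Pregraphs and turns -/

namespace Pregraph

variable {V : Type u} {H : SimpleGraph V} {G G' G'' : Pregraph H}

lemma ExtendedBy.refl (G : Pregraph H) : G.ExtendedBy G := ⟨subset_rfl, subset_rfl⟩

lemma ExtendedBy.trans (h : G.ExtendedBy G') (h' : G'.ExtendedBy G'') : G.ExtendedBy G'' :=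
  ⟨h.1.trans h'.1, h.2.trans h'.2⟩

lemma ExtendedBy.determined_subset (h : G.ExtendedBy G') : G.determined ⊆ G'.determined :=
  Set.union_subset_union h.1 h.2

lemma edges_subset_determined (G : Pregraph H) : G.edges ⊆ G.determined :=
  Set.subset_union_left

lemma edges_subset_edgeSet (G : Pregraph H) : G.edges ⊆ H.edgeSet :=
  Set.subset_union_left.trans G.union_subset

lemma notMem_nonedges_of_mem_edges {e : Sym2 V} (he : e ∈ G.edges) : e ∉ G.nonedges := fun h => by
  have : e ∈ G.edges ∩ G.nonedges := ⟨he, h⟩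
  simp [G.inter_eq_empty] at this

/-- A pair already determined keeps its value. -/
lemma ExtendedBy.mem_edges_of_mem_determined (h : G.ExtendedBy G') {e : Sym2 V}
    (he : e ∈ G'.edges) (hd : e ∈ G.determined) : e ∈ G.edges :=
  hd.resolve_right fun hn => notMem_nonedges_of_mem_edges he (h.2 hn)

lemma determined_ne_edgeSet {e : Sym2 V} (he : e ∈ G.undetermined) :
    G.determined ≠ H.edgeSet := fun h => he.2 (h ▸ he.1)

/-- The new edges of a graph extending `G` are undetermined in `G`. -/
lemma ExtendedByGraph.mem_undetermined {F : SimpleGraph V} (h : G.ExtendedByGraph F)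
    {e : Sym2 V} (he : e ∈ F.edgeSet) (hG : e ∉ G.edges) : e ∈ G.undetermined := by
  refine ⟨SimpleGraph.edgeSet_mono h.1 he, ?_⟩
  rintro (h' | h')
  · exact hG h'
  · exact Set.disjoint_left.1 (SimpleGraph.disjoint_edgeSet.2 disjoint_compl_right) he (h.2.2 h')

end Pregraph

section Turn

variable {V : Type u} {H : SimpleGraph V} {G G' : Pregraph H} {e : Sym2 V}

lemma IsTurn.edges_eq (h : IsTurn H G e G') : G'.edges = G.edges ∨ G'.edges = insert e G.edges := by
  have hsub : G'.edges ⊆ insert e G.edges := fun x hx => by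
    have : x ∈ G.determined ∪ {e} := h.2.2 ▸ G'.edges_subset_determined hx
    rcases this with h' | h'
    · exact Or.inr (h.2.1.mem_edges_of_mem_determined hx h')
    · exact Or.inl h'
  by_cases he : e ∈ G'.edges
  · exact Or.inr (hsub.antisymm (Set.insert_subset he h.2.1.1))
  · refine Or.inl (Set.Subset.antisymm (fun x hx => ?_) h.2.1.1)
    rcases hsub hx with rfl | h'
    · exact absurd hx he
    · exact h'

end Turn

/-! ### The game started from an arbitrary position -/

section Game

variable {V : Type u} (H : SimpleGraph V) (R : SimpleGraph V → Prop)

/-- The analogue of `IsRunFollowing` for the game that starts at the position `G₀` instead of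
the empty pregraph. -/
structure IsRunFrom (G₀ : Pregraph H) (σ : AliceStrategy H) (β : Ordinal.{u})
    (G : Ordinal.{u} → Pregraph H) : Prop where
  zero : G 0 = G₀
  limit_edges : ∀ α ≤ β, Order.IsSuccLimit α → (G α).edges = ⋃ ζ < α, (G ζ).edges
  limit_nonedges : ∀ α ≤ β, Order.IsSuccLimit α → (G α).nonedges = ⋃ ζ < α, (G ζ).nonedges
  not_terminated : ∀ γ < β, ¬ Terminated H R (G γ)
  turn : ∀ γ < β, IsTurn H (G γ) (σ γ (fun α => G α)) (G (Order.succ γ))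

/-- Alice has a winning strategy in the game that starts at the position `G₀`. -/
def AliceWinsFrom (G₀ : Pregraph H) : Prop :=
  ∃ σ : AliceStrategy H, ∀ (β : Ordinal.{u}) (G : Ordinal.{u} → Pregraph H),
    IsRunFrom H R G₀ σ β G →
      (¬ Terminated H R (G β) → σ β (fun α => G α) ∈ (G β).undetermined) ∧
      (Terminated H R (G β) → (G β).determined ≠ H.edgeSet)

variable {H R}

lemma AliceWinsFrom.aliceHasWinningStrategy (h : AliceWinsFrom H R (Pregraph.empty H)) :
    AliceHasWinningStrategy H R := by
  obtain ⟨σ, hσ⟩ := h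
  exact ⟨σ, fun β G hG =>
    hσ β G ⟨hG.zero, hG.limit_edges, hG.limit_nonedges, hG.not_terminated, hG.turn⟩⟩

lemma IsRunFrom.extendedBy {G₀ : Pregraph H} {σ : AliceStrategy H} {β : Ordinal.{u}}
    {G : Ordinal.{u} → Pregraph H} (hG : IsRunFrom H R G₀ σ β G) {ζ ξ : Ordinal.{u}}
    (hζ : ζ ≤ ξ) (hξ : ξ ≤ β) : (G ζ).ExtendedBy (G ξ) := by
  induction ξ using Ordinal.limitRecOn with
  | zero =>
    obtain rfl : ζ = 0 := by simpa using hζ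
    exact .refl _
  | add_one ξ ih =>
    rw [← Order.succ_eq_add_one] at *
    rcases hζ.eq_or_lt with rfl | h
    · exact .refl _
    · have hlt : ξ < β := Order.succ_le_iff.1 hξ
      exact (ih (Order.lt_succ_iff.1 h) hlt.le).trans (hG.turn ξ hlt).2.1
  | limit ξ hl _ =>
    rcases hζ.eq_or_lt with rfl | h
    · exact .refl _
    · refine ⟨?_, ?_⟩
      · rw [hG.limit_edges ξ hξ hl]
        exact Set.subset_biUnion_of_mem (u := fun ζ => (G ζ).edges) h
      · rw [hG.limit_nonedges ξ hξ hl]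
        exact Set.subset_biUnion_of_mem (u := fun ζ => (G ζ).nonedges) h

/-- The part of a run after stage `δ`, reindexed to begin at stage `0`, is a run that starts at the
position of stage `δ`, and follows any `τ` with which `σ` agrees from then on. -/
lemma IsRunFrom.shift {G₀ : Pregraph H} {σ τ : AliceStrategy H} {β δ : Ordinal.{u}}
    {G : Ordinal.{u} → Pregraph H} (hG : IsRunFrom H R G₀ σ β G) (hδ : δ ≤ β)
    (hστ : ∀ ε, δ + ε ≤ β → σ (δ + ε) (fun α => G α) = τ ε (fun α => G (δ + α))) :
    IsRunFrom H R (G δ) τ (β - δ) (fun ε => G (δ + ε)) := by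
  have hle {ε : Ordinal.{u}} (h : ε ≤ β - δ) : δ + ε ≤ β := by
    rw [← Ordinal.add_sub_cancel_of_le hδ]; gcongr
  have hlt {ε : Ordinal.{u}} (h : ε < β - δ) : δ + ε < β := Ordinal.lt_sub.1 h
  have hlim {α : Ordinal.{u}} (s : Pregraph H → Set (Sym2 V))
      (hs : ∀ ζ ξ, ζ ≤ ξ → ξ ≤ β → s (G ζ) ⊆ s (G ξ)) (hα : α ≤ β - δ)
      (hl : Order.IsSuccLimit α) :
      ⋃ ζ < δ + α, s (G ζ) = ⋃ ζ < α, s (G (δ + ζ)) := by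
    apply Set.Subset.antisymm
    · refine Set.iUnion₂_subset fun ζ hζ => ?_
      obtain ⟨d, hd, hζd⟩ := (Ordinal.lt_add_iff_of_isSuccLimit hl).1 hζ
      exact (hs _ _ hζd.le (hle (hd.le.trans hα))).trans
        (Set.subset_biUnion_of_mem (u := fun ζ => s (G (δ + ζ))) hd)
    · refine Set.iUnion₂_subset fun ζ hζ => ?_
      exact Set.subset_biUnion_of_mem (u := fun ζ => s (G ζ))
        (show δ + ζ < δ + α by gcongr)
  refine ⟨by simp, fun α hα hl => ?_, fun α hα hl => ?_, fun γ hγ => ?_, fun γ hγ => ?_⟩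
  · rw [hG.limit_edges _ (hle hα) (Ordinal.isSuccLimit_add _ hl)]
    exact hlim (fun P => P.edges) (fun _ _ h h' => (hG.extendedBy h h').1) hα hl
  · rw [hG.limit_nonedges _ (hle hα) (Ordinal.isSuccLimit_add _ hl)]
    exact hlim (fun P => P.nonedges) (fun _ _ h h' => (hG.extendedBy h h').2) hα hl
  · exact hG.not_terminated _ (hlt hγ)
  · have := hG.turn _ (hlt hγ)
    rw [hστ _ (hlt hγ).le] at this
    rwa [Order.succ_eq_add_one, ← add_assoc, ← Order.succ_eq_add_one]

/-- A terminal position is won as soon as one pair is undetermined, since no run continues it. -/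
lemma AliceWinsFrom.of_terminated {G₀ : Pregraph H} (ht : Terminated H R G₀) {e : Sym2 V}
    (he : e ∈ G₀.undetermined) : AliceWinsFrom H R G₀ := by
  refine ⟨fun _ _ => e, fun β G hG => ?_⟩
  obtain rfl : β = 0 := by
    by_contra hβ
    exact hG.not_terminated 0 (pos_iff_ne_zero.2 hβ) (hG.zero ▸ ht)
  rw [hG.zero]
  exact ⟨fun h => absurd ht h, fun _ => Pregraph.determined_ne_edgeSet he⟩

open Classical in
/-- Composition of strategies. Alice plays the undetermined pairs given by `pick` until the
position satisfies `halt`, and then switches to a winning strategy from the position reached.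
The invariant `J` holds at all positions of this phase, and has to be preserved by turns and by
unions at limit stages of positions that do not satisfy `halt`. -/
theorem AliceWinsFrom.of_phase {G₀ : Pregraph H} (J halt : Pregraph H → Prop)
    (pick : Pregraph H → Sym2 V) (h_zero : J G₀)
    (h_pick : ∀ G, J G → ¬ halt G → pick G ∈ G.undetermined)
    (h_turn : ∀ G, J G → ¬ halt G → ∀ G', IsTurn H G (pick G) G' → J G')
    (h_limit : ∀ (α : Ordinal.{u}) (G : Ordinal.{u} → Pregraph H), Order.IsSuccLimit α →
      (∀ ζ < α, J (G ζ)) → (∀ ζ < α, ¬ halt (G ζ)) →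
      (G α).edges = ⋃ ζ < α, (G ζ).edges → (G α).nonedges = ⋃ ζ < α, (G ζ).nonedges → J (G α))
    (h_halt : ∀ G, J G → halt G → AliceWinsFrom H R G) : AliceWinsFrom H R G₀ := by
  have : ∀ G, ∃ σ : AliceStrategy H, J G → halt G → ∀ (β : Ordinal.{u})
      (G' : Ordinal.{u} → Pregraph H), IsRunFrom H R G σ β G' →
      (¬ Terminated H R (G' β) → σ β (fun α => G' α) ∈ (G' β).undetermined) ∧
      (Terminated H R (G' β) → (G' β).determined ≠ H.edgeSet) := fun G => by
    by_cases h : J G ∧ halt G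
    · obtain ⟨σ, hσ⟩ := h_halt G h.1 h.2
      exact ⟨σ, fun _ _ => hσ⟩
    · exact ⟨fun _ _ => pick G, fun h1 h2 => absurd ⟨h1, h2⟩ h⟩
  choose τ hτ using this
  -- The history, continued arbitrarily beyond the current stage.
  let ext : (γ : Ordinal.{u}) → (Set.Iic γ → Pregraph H) → Ordinal.{u} → Pregraph H :=
    fun γ hist α => if h : α ≤ γ then hist ⟨α, h⟩ else G₀
  -- The first stage, up to stage `γ`, whose position satisfies `halt`.
  let first : (Ordinal.{u} → Pregraph H) → Ordinal.{u} → Ordinal.{u} :=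
    fun g γ => sInf {δ | δ ≤ γ ∧ halt (g δ)}
  let σ : AliceStrategy H := fun γ hist =>
    let g := ext γ hist
    if ∃ δ ≤ γ, halt (g δ) then
      τ (g (first g γ)) (γ - first g γ) (fun ε => g (first g γ + ε))
    else pick (g γ)
  have hext (γ : Ordinal.{u}) (G : Ordinal.{u} → Pregraph H) (α : Ordinal.{u}) (hα : α ≤ γ) :
      ext γ (fun α => G α) α = G α := by simp [ext, hα]
  refine ⟨σ, fun β G hG => ?_⟩
  have σ_before (γ : Ordinal.{u}) (h : ∀ δ ≤ γ, ¬ halt (G δ)) :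
      σ γ (fun α => G α) = pick (G γ) := by
    have : ¬ ∃ δ ≤ γ, halt (ext γ (fun α => G α) δ) := by
      rintro ⟨δ, hδ, hs⟩
      exact h δ hδ (hext γ G δ hδ ▸ hs)
    simp only [σ, if_neg this, hext γ G γ le_rfl]
  have σ_after (δ : Ordinal.{u}) (hs : halt (G δ)) (hmin : ∀ ζ < δ, ¬ halt (G ζ))
      (ε : Ordinal.{u}) :
      σ (δ + ε) (fun α => G α) = τ (G δ) ε (fun α => G (δ + α)) := by
    have hδ : δ ≤ δ + ε := by simp
    have h1 : ∃ ζ ≤ δ + ε, halt (ext (δ + ε) (fun α => G α) ζ) :=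
      ⟨δ, hδ, by rwa [hext _ G δ hδ]⟩
    have h2 : first (ext (δ + ε) (fun α => G α)) (δ + ε) = δ := by
      refine IsLeast.csInf_eq ⟨⟨hδ, by rwa [hext _ G δ hδ]⟩, ?_⟩
      rintro ζ ⟨hζ, hζs⟩
      rw [hext _ G ζ hζ] at hζs
      exact not_lt.1 fun h => hmin ζ h hζs
    have h3 : ∀ (g : Ordinal.{u} → Pregraph H) (d ξ : Ordinal.{u}), d = δ → ξ = ε → g d = G δ →
        (∀ x ≤ ε, g (δ + x) = G (δ + x)) →
        τ (g d) ξ (fun x => g (d + x)) = τ (G δ) ε (fun x => G (δ + x)) := by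
      rintro g _ _ rfl rfl hg hx
      rw [hg]
      congr 1
      funext x
      exact hx _ x.2
    simp only [σ, if_pos h1]
    exact h3 _ _ _ h2 (by rw [h2, Ordinal.add_sub_cancel]) (by rw [h2, hext _ G δ hδ])
      fun x hx => hext _ G _ (by gcongr)
  have hJ (α : Ordinal.{u}) (hα : α ≤ β) (h : ∀ ζ < α, ¬ halt (G ζ)) : J (G α) := by
    induction α using Ordinal.limitRecOn with
    | zero => rw [hG.zero]; exact h_zero
    | add_one α ih =>
      rw [← Order.succ_eq_add_one] at *
      have hlt : α < β := Order.succ_le_iff.1 hα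
      have hs : ∀ δ ≤ α, ¬ halt (G δ) := fun δ hδ => h δ (Order.lt_succ_iff.2 hδ)
      have hturn := hG.turn α hlt
      rw [σ_before α hs] at hturn
      exact h_turn _ (ih hlt.le fun ζ hζ => hs ζ hζ.le) (hs α le_rfl) _ hturn
    | limit α hl ih =>
      exact h_limit α G hl
        (fun ζ hζ => ih ζ hζ (hζ.le.trans hα) fun ξ hξ => h ξ (hξ.trans hζ)) h
        (hG.limit_edges α hα hl) (hG.limit_nonedges α hα hl)
  by_cases h_ex : ∃ δ ≤ β, halt (G δ)
  · have hne : {δ | δ ≤ β ∧ halt (G δ)}.Nonempty := h_ex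
    obtain ⟨hδβ, hδs⟩ := csInf_mem hne
    set δ := sInf {δ | δ ≤ β ∧ halt (G δ)} with hδ
    have hmin : ∀ ζ < δ, ¬ halt (G ζ) := fun ζ hζ hs =>
      notMem_of_lt_csInf' hζ ⟨hζ.le.trans hδβ, hs⟩
    have hrun := hG.shift hδβ fun ε _ => σ_after δ hδs hmin ε
    have hfin := hτ (G δ) (hJ δ hδβ hmin) hδs _ _ hrun
    have hβ : δ + (β - δ) = β := Ordinal.add_sub_cancel_of_le hδβ
    have key := σ_after δ hδs hmin (β - δ)
    rw [← key] at hfin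
    rwa [hβ] at hfin
  · push Not at h_ex
    have hJβ : J (G β) := hJ β le_rfl fun ζ hζ => h_ex ζ hζ.le
    have hpick := h_pick _ hJβ (h_ex β le_rfl)
    rw [σ_before β h_ex]
    exact ⟨fun _ => hpick, fun _ => Pregraph.determined_ne_edgeSet hpick⟩

/-! ### Two kinds of phases -/

/-- In a limit position, the determined pairs are those determined before. -/
lemma determined_eq_iUnion {α : Ordinal.{u}} {G : Ordinal.{u} → Pregraph H}
    (hE : (G α).edges = ⋃ ζ < α, (G ζ).edges) (hN : (G α).nonedges = ⋃ ζ < α, (G ζ).nonedges) :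
    (G α).determined = ⋃ ζ < α, (G ζ).determined := by
  simp only [Pregraph.determined, hE, hN, Set.iUnion_union_distrib]

/-- Alice wins if she wins from each position that results from asking all the pairs of `A`,
whatever Bob's answers are. -/
theorem AliceWinsFrom.of_ask_all {G₀ : Pregraph H} (A : Set (Sym2 V))
    (h : ∀ G, G₀.ExtendedBy G → G.determined = G₀.determined ∪ (A ∩ H.edgeSet) →
      AliceWinsFrom H R G) :
    AliceWinsFrom H R G₀ := by
  by_cases h0 : A ∩ H.edgeSet ⊆ G₀.determined
  · exact h G₀ (.refl _) (Set.union_eq_left.2 h0).symm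
  -- `e₀` only serves as a default value of the choice function `pick`.
  obtain ⟨e₀, -⟩ := Set.not_subset.1 h0
  have : ∀ G : Pregraph H, ∃ e, ¬ A ∩ H.edgeSet ⊆ G.determined →
      e ∈ A ∩ H.edgeSet ∧ e ∉ G.determined := fun G => by
    by_cases hG : A ∩ H.edgeSet ⊆ G.determined
    · exact ⟨e₀, fun h => absurd hG h⟩
    · obtain ⟨e, he⟩ := Set.not_subset.1 hG
      exact ⟨e, fun _ => he⟩
  choose pick hpick using this
  refine .of_phase
    (fun G => G₀.ExtendedBy G ∧ G.determined ⊆ G₀.determined ∪ (A ∩ H.edgeSet))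
    (fun G => A ∩ H.edgeSet ⊆ G.determined) pick
    ⟨.refl _, Set.subset_union_left⟩ ?_ ?_ ?_ ?_
  · intro G _ hs
    exact ⟨(hpick G hs).1.2, (hpick G hs).2⟩
  · intro G hJ hs G' ht
    refine ⟨hJ.1.trans ht.2.1, ?_⟩
    rw [ht.2.2]
    exact Set.union_subset hJ.2 (Set.singleton_subset_iff.2 (Or.inr (hpick G hs).1))
  · intro α G hl hJ _ hE hN
    have h0 := (hJ 0 hl.bot_lt).1
    refine ⟨⟨h0.1.trans ?_, h0.2.trans ?_⟩, ?_⟩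
    · rw [hE]; exact Set.subset_biUnion_of_mem (u := fun ζ => (G ζ).edges) hl.bot_lt
    · rw [hN]; exact Set.subset_biUnion_of_mem (u := fun ζ => (G ζ).nonedges) hl.bot_lt
    · rw [determined_eq_iUnion hE hN]
      exact Set.iUnion₂_subset fun ζ hζ => (hJ ζ hζ).2
  · intro G hJ hs
    exact h G hJ.1 (hJ.2.antisymm (Set.union_subset hJ.1.determined_subset hs))

/-- The elements of an infinite set can be ranked by a well-ordered type in such a way that
infinitely many of them come after each one: the type is the initial ordinal of the set. -/
lemma exists_rank_of_infinite {α : Type u} {A : Set α} (hA : A.Infinite) :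
    ∃ (ι : Type u) (_ : LinearOrder ι) (_ : WellFoundedLT ι) (ρ : α → ι),
      ∀ a ∈ A, {b ∈ A | ρ a < ρ b}.Infinite := by
  classical
  have hA' : Cardinal.aleph0 ≤ Cardinal.mk A := by
    rwa [Cardinal.aleph0_le_mk_iff, Set.infinite_coe_iff]
  obtain ⟨f⟩ : Nonempty (A ≃ (Cardinal.mk A).ord.ToType) := Cardinal.eq.1 (by simp)
  have := Cardinal.noMaxOrder hA'
  obtain ⟨a₀, ha₀⟩ := hA.nonempty
  let ρ : α → (Cardinal.mk A).ord.ToType := fun a => if h : a ∈ A then f ⟨a, h⟩ else f ⟨a₀, ha₀⟩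
  have hρ {a : α} (h : a ∈ A) : ρ a = f ⟨a, h⟩ := dif_pos h
  refine ⟨_, inferInstance, inferInstance, ρ, fun a ha => ?_⟩
  refine Set.Infinite.mono (s := (fun i => (f.symm i : α)) '' Set.Ioi (ρ a)) ?_ ?_
  · rintro _ ⟨i, hi, rfl⟩
    refine ⟨(f.symm i).2, ?_⟩
    rw [hρ (f.symm i).2]
    simpa using hi
  · exact (Set.Ioi_infinite _).image (Subtype.val_injective.comp f.symm.injective).injOn

/-- Alice may ask the pairs of an infinite set `A` until Bob accepts one of them as an edge. The
pairs are asked in an order that has no last element, and such that infinitely many pairs of `A`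
are still undetermined when Bob accepts one. -/
theorem AliceWinsFrom.of_ask_until_edge {G₀ : Pregraph H} {A : Set (Sym2 V)} (hA : A.Infinite)
    (hAU : A ⊆ G₀.undetermined)
    (h_no : ∀ G, G₀.ExtendedBy G → G.edges = G₀.edges → G.determined = G₀.determined ∪ A →
      AliceWinsFrom H R G)
    (h_yes : ∀ G, ∀ e ∈ A, G₀.ExtendedBy G → G.edges = insert e G₀.edges →
      G.determined ⊆ G₀.determined ∪ A → (A ∩ G.undetermined).Infinite →
      AliceWinsFrom H R G) :
    AliceWinsFrom H R G₀ := by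
  obtain ⟨ι, _, _, ρ, hρ⟩ := exists_rank_of_infinite hA
  -- `e₀` only serves as a default value of the choice function `pick`.
  obtain ⟨e₀, he₀⟩ := hA.nonempty
  have : ∀ G : Pregraph H, ∃ e, ¬ A ⊆ G.determined →
      (e ∈ A ∧ e ∉ G.determined) ∧ ∀ b ∈ A, b ∉ G.determined → ρ e ≤ ρ b := fun G => by
    by_cases hG : A ⊆ G.determined
    · exact ⟨e₀, fun h => absurd hG h⟩
    · have hne : (A \ G.determined).Nonempty := by
        obtain ⟨a, ha⟩ := Set.not_subset.1 hG
        exact ⟨a, ha⟩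
      obtain ⟨_, ⟨e, he, rfl⟩, hmin⟩ := wellFounded_lt.has_min (ρ '' (A \ G.determined)) (hne.image ρ)
      exact ⟨e, fun _ => ⟨he, fun b hb hb' => not_lt.1 (hmin _ ⟨b, ⟨hb, hb'⟩, rfl⟩)⟩⟩
  choose pick hpick using this
  -- The pairs of `A` are asked in the order of `ρ`, so that the determined ones form an initial
  -- segment. A new edge appears at a successor stage only, hence the stopping position has at most
  -- one new edge, and the pairs after that edge are still undetermined.
  refine .of_phase
    (fun G => G₀.ExtendedBy G ∧ G.determined ⊆ G₀.determined ∪ A ∧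
      (∀ a ∈ A, ∀ b ∈ A, ρ b < ρ a → a ∈ G.determined → b ∈ G.determined) ∧
      (G.edges = G₀.edges ∨ ∃ e ∈ A, G.edges = insert e G₀.edges ∧ (A ∩ G.undetermined).Infinite))
    (fun G => G.edges ≠ G₀.edges ∨ A ⊆ G.determined) pick
    ⟨.refl _, Set.subset_union_left, fun a ha _ _ _ h => absurd h (hAU ha).2, .inl rfl⟩
    ?_ ?_ ?_ ?_
  · intro G _ hs
    push Not at hs
    have := (hpick G hs.2).1
    exact ⟨(hAU this.1).1, this.2⟩
  · rintro G ⟨hext, hsub, hlow, -⟩ hs G' ht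
    push Not at hs
    obtain ⟨⟨hpA, hpG⟩, hmin⟩ := hpick G hs.2
    refine ⟨hext.trans ht.2.1, ?_, ?_, ?_⟩
    · rw [ht.2.2]
      exact Set.union_subset hsub (Set.singleton_subset_iff.2 (Or.inr hpA))
    · intro a ha b hb hab had
      by_contra hbd
      rw [ht.2.2] at had hbd
      simp only [Set.mem_union, Set.mem_singleton_iff, not_or] at had hbd
      rcases had with had | rfl
      · exact hbd.1 (hlow a ha b hb hab had)
      · exact (hmin b hb hbd.1).not_gt hab
    · rcases ht.edges_eq with h | h
      · exact .inl (h.trans hs.1)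
      · refine .inr ⟨_, hpA, by rw [h, hs.1], (hρ _ hpA).mono ?_⟩
        rintro b ⟨hb, hlt⟩
        refine ⟨hb, (hAU hb).1, fun hbd => ?_⟩
        rw [ht.2.2] at hbd
        rcases hbd with hbd | rfl
        · exact hpG (hlow b hb _ hpA hlt hbd)
        · exact hlt.false
  · intro α G hl hJ hs hE hN
    have h0 := (hJ 0 hl.bot_lt).1
    have hedges : (G α).edges = G₀.edges := by
      rw [hE]
      refine Set.Subset.antisymm (Set.iUnion₂_subset fun ζ hζ => ?_) ?_
      · have := hs ζ hζ
        push Not at this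
        exact this.1.subset
      · exact h0.1.trans (Set.subset_biUnion_of_mem (u := fun ζ => (G ζ).edges) hl.bot_lt)
    refine ⟨⟨hedges.superset, h0.2.trans ?_⟩, ?_, ?_, .inl hedges⟩
    · rw [hN]; exact Set.subset_biUnion_of_mem (u := fun ζ => (G ζ).nonedges) hl.bot_lt
    · rw [determined_eq_iUnion hE hN]
      exact Set.iUnion₂_subset fun ζ hζ => (hJ ζ hζ).2.1
    · intro a ha b hb hab
      rw [determined_eq_iUnion hE hN]
      simp only [Set.mem_iUnion]
      rintro ⟨ζ, hζ, h⟩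
      exact ⟨ζ, hζ, (hJ ζ hζ).2.2.1 a ha b hb hab h⟩
  · rintro G ⟨hext, hsub, -, hE⟩ hs
    rcases hE with hE | ⟨e, he, hE, hinf⟩
    · exact h_no G hext hE (hsub.antisymm
        (Set.union_subset hext.determined_subset (hs.resolve_left fun h => h hE)))
    · exact h_yes G e he hext hE hsub hinf

end Game

/-! ### Properties given by the size of a set attached to each vertex -/

/-- A set `nbhd E v` of vertices attached to each vertex `v` of the graph with the edge set `E`,
such as the set of neighbors of `v` or the connected component of `v`. The set
`core v (nbhd E v)` consists of the vertices whose incident edges decide what `nbhd E v` is: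
as long as no edge at the core is added, `nbhd E v` does not change. The core is `{v}` for
neighborhoods, and the whole component for components. -/
structure GrowingNbhd (V : Type u) where
  /-- The set attached to a vertex, for a given set of edges. -/
  nbhd : Set (Sym2 V) → V → Set V
  /-- The core of a vertex, as a function of the set attached to the vertex. -/
  core : V → Set V → Set V
  nbhd_mono : ∀ {E E' : Set (Sym2 V)}, E ⊆ E' → ∀ v, nbhd E v ⊆ nbhd E' v
  core_mono : ∀ v {N N' : Set V}, N ⊆ N' → core v N ⊆ core v N'
  core_subset : ∀ v N, core v N ⊆ insert v N
  self_mem_core : ∀ E v, v ∈ core v (nbhd E v)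
  mem_nbhd_of_mem : ∀ {E : Set (Sym2 V)} {v x : V}, v ≠ x → s(v, x) ∈ E → x ∈ nbhd E v
  nbhd_stable : ∀ {E E' : Set (Sym2 V)} {v : V}, E ⊆ E' →
    (∀ e ∈ E', e ∉ E → ∀ x ∈ core v (nbhd E v), x ∉ e) → nbhd E' v = nbhd E v
  nbhd_eq_of_mem_core : ∀ {E : Set (Sym2 V)} {v x : V}, x ∈ core v (nbhd E v) →
    nbhd E x = nbhd E v
  mem_nbhd_of_mem_core : ∀ {E : Set (Sym2 V)} {v x : V}, x ∈ core v (nbhd E v) →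
    x = v ∨ v ∈ nbhd E x
  mem_nbhd_of_adj_core : ∀ {E : Set (Sym2 V)} {v x w : V}, x ∈ core v (nbhd E v) → x ≠ w →
    s(x, w) ∈ E → v ∈ nbhd E w

namespace GrowingNbhd

variable {V : Type u} (P : GrowingNbhd V) (t : ℕ)

/-- The set attached to `v` has at least `t` elements. -/
def Large (E : Set (Sym2 V)) (v : V) : Prop := (t : ℕ∞) ≤ (P.nbhd E v).encard

/-- The property that the sets attached to all vertices have at least `t` elements. -/
def property (F : SimpleGraph V) : Prop := ∀ v, P.Large t F.edgeSet v

variable {P t}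

lemma Large.mono {E E' : Set (Sym2 V)} {v : V} (h : P.Large t E v) (hE : E ⊆ E') :
    P.Large t E' v :=
  le_trans h (Set.encard_le_encard (P.nbhd_mono hE v))

lemma core_nbhd_mono {E E' : Set (Sym2 V)} (hE : E ⊆ E') (v : V) :
    P.core v (P.nbhd E v) ⊆ P.core v (P.nbhd E' v) :=
  P.core_mono v (P.nbhd_mono hE v)

lemma finite_nbhd {E : Set (Sym2 V)} {v : V} (h : ¬ P.Large t E v) : (P.nbhd E v).Finite :=
  Set.finite_of_encard_le_coe (not_le.1 h).le

lemma finite_core {E : Set (Sym2 V)} {v : V} (h : ¬ P.Large t E v) :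
    (P.core v (P.nbhd E v)).Finite :=
  ((finite_nbhd h).insert v).subset (P.core_subset _ _)

lemma encard_core_le {E : Set (Sym2 V)} {v : V} (h : ¬ P.Large t E v) :
    (P.core v (P.nbhd E v)).encard ≤ t :=
  calc (P.core v (P.nbhd E v)).encard ≤ (insert v (P.nbhd E v)).encard :=
        Set.encard_le_encard (P.core_subset _ _)
    _ ≤ (P.nbhd E v).encard + 1 := Set.encard_insert_le _ _
    _ ≤ t := Order.add_one_le_of_lt (not_le.1 h)

lemma notMem_core_of_large {E : Set (Sym2 V)} {v x : V} (h : ¬ P.Large t E v)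
    (hx : P.Large t E x) : x ∉ P.core v (P.nbhd E v) := fun hc => by
  rw [Large, P.nbhd_eq_of_mem_core hc] at hx
  exact h hx

variable {H : SimpleGraph V}

/-- A vertex with a small set, all of whose relevant pairs are determined, refutes the property. -/
lemma terminated_of_not_large {G : Pregraph H} {v : V} (hv : ¬ P.Large t G.edges v)
    (h : ∀ e ∈ G.undetermined, ∀ x ∈ P.core v (P.nbhd G.edges v), x ∉ e) :
    Terminated H (P.property t) G := by
  refine .inr fun F hF hprop => hv ?_
  have hst := P.nbhd_stable hF.2.1 fun e he he' => h e (hF.mem_undetermined he he')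
  have := hprop v
  rwa [Large, hst] at this

/-- A pair between two vertices that already have large sets is irrelevant, so that Alice wins by
asking all the other pairs. -/
lemma aliceWinsFrom_of_large_of_large {G₀ : Pregraph H} {x y : V} (hx : P.Large t G₀.edges x)
    (hy : P.Large t G₀.edges y) (hxy : s(x, y) ∈ G₀.undetermined) :
    AliceWinsFrom H (P.property t) G₀ := by
  refine .of_ask_all {s(x, y)}ᶜ fun G hG hdet => ?_
  have hxyG : s(x, y) ∈ G.undetermined := by
    refine ⟨hxy.1, fun h => ?_⟩
    rw [hdet] at h
    rcases h with h | h
    · exact hxy.2 h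
    · exact h.1 rfl
  refine .of_terminated ?_ hxyG
  by_cases hall : ∀ v, P.Large t G.edges v
  · exact .inl fun F hF v => (hall v).mono hF.2.1
  push Not at hall
  obtain ⟨v, hv⟩ := hall
  refine terminated_of_not_large hv fun e he z hz hze => ?_
  obtain rfl : e = s(x, y) := by
    by_contra hne
    exact he.2 (hdet ▸ Or.inr ⟨hne, he.1⟩)
  rcases Sym2.mem_iff.1 hze with rfl | rfl
  · exact notMem_core_of_large hv (hx.mono hG.1) hz
  · exact notMem_core_of_large hv (hy.mono hG.1) hz

/-! ### Making a vertex large -/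

/-- Suppose that `s(v, x)` is undetermined for infinitely many `x ∈ A`. Then Alice can force Bob
to make the set attached to `v` large while infinitely many of these pairs remain undetermined.
If Bob refuses, then all the pairs that are relevant for `v` become determined, and the game
terminates, while by `h_side` some pair that is irrelevant for `v` is still undetermined. -/
theorem aliceWinsFrom_of_search {G₀ : Pregraph H} {v : V} {A : Set V} (hA : A.Infinite)
    (hAU : ∀ x ∈ A, s(v, x) ∈ G₀.undetermined)
    (h_side : ∀ G, G₀.ExtendedBy G → ¬ P.Large t G.edges v →
      G.determined ⊆ G₀.determined ∪ {e | ∃ x ∈ P.core v (P.nbhd G.edges v), x ∈ e} →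
      ∃ e ∈ G.undetermined, ∀ x ∈ P.core v (P.nbhd G.edges v), x ∉ e)
    (h_large : ∀ G, G₀.ExtendedBy G → P.Large t G.edges v →
      (∃ T : Set V, T.Finite ∧ G.determined ⊆ G₀.determined ∪ {e | ∃ x ∈ T, x ∈ e}) →
      {x ∈ A | s(v, x) ∈ G.undetermined}.Infinite → AliceWinsFrom H (P.property t) G) :
    AliceWinsFrom H (P.property t) G₀ := by
  -- Induction on the number `k` of vertices that the set attached to `v` still lacks.
  suffices key : ∀ k : ℕ, ∀ G, G₀.ExtendedBy G → (t : ℕ∞) ≤ k + (P.nbhd G.edges v).encard →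
      (∃ T : Set V, T.Finite ∧ T ⊆ P.core v (P.nbhd G.edges v) ∧
        G.determined ⊆ G₀.determined ∪ {e | ∃ x ∈ T, x ∈ e}) →
      {x ∈ A | s(v, x) ∈ G.undetermined}.Infinite → AliceWinsFrom H (P.property t) G by
    refine key t G₀ (.refl _) le_self_add ⟨∅, Set.finite_empty, Set.empty_subset _, by simp⟩ ?_
    exact hA.mono fun x hx => ⟨hx, hAU x hx⟩
  intro k
  induction k with
  | zero =>
    rintro G hG hk ⟨T, hT, -, hdet⟩ hinf
    exact h_large G hG (by simpa [Large] using hk) ⟨T, hT, hdet⟩ hinf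
  | succ k ih =>
    rintro G hG hk ⟨T, hT, hTS, hdet⟩ hinf
    by_cases hv : P.Large t G.edges v
    · exact h_large G hG hv ⟨T, hT, hdet⟩ hinf
    have hgrow {G' : Pregraph H} {y : V} (hG' : G.ExtendedBy G') (hy : y ∈ P.nbhd G'.edges v)
        (hy' : y ∉ P.nbhd G.edges v) : (t : ℕ∞) ≤ k + (P.nbhd G'.edges v).encard := by
      have h1 : (P.nbhd G.edges v).encard + 1 ≤ (P.nbhd G'.edges v).encard := by
        rw [← Set.encard_insert_of_notMem hy']
        exact Set.encard_le_encard (Set.insert_subset hy (P.nbhd_mono hG'.1 v))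
      calc (t : ℕ∞) ≤ (k + 1 : ℕ) + (P.nbhd G.edges v).encard := hk
        _ = k + ((P.nbhd G.edges v).encard + 1) := by push_cast; ring
        _ ≤ _ := by gcongr
    set S := P.core v (P.nbhd G.edges v) with hS
    have hSfin : S.Finite := finite_core hv
    set B : Set V := {x ∈ A | s(v, x) ∈ G.undetermined} \ P.nbhd G.edges v with hB
    have hBinf : B.Infinite := hinf.sdiff (finite_nbhd hv)
    have hinj : Function.Injective fun x => s(v, x) := fun x y h => Sym2.congr_right.1 h
    have hdet' : G.determined ⊆ G₀.determined ∪ {e | ∃ x ∈ S, x ∈ e} :=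
      hdet.trans (Set.union_subset_union_right _ fun e ⟨x, hx, hxe⟩ => ⟨x, hTS hx, hxe⟩)
    -- First all the pairs at the core are asked, except the pairs `s(v, x)` with `x ∈ B`. If this
    -- does not enlarge the set attached to `v`, then these pairs are asked until the first edge.
    refine .of_ask_all ({e | ∃ x ∈ S, x ∈ e} \ (fun x => s(v, x)) '' B) fun G₁ hG₁ hd₁ => ?_
    have hd₁S : G₁.determined ⊆ G₀.determined ∪ {e | ∃ x ∈ S, x ∈ e} := by
      rw [hd₁]
      exact Set.union_subset hdet' fun e he => Or.inr he.1.1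
    have hBU : (fun x => s(v, x)) '' B ⊆ G₁.undetermined := by
      rintro _ ⟨x, hx, rfl⟩
      refine ⟨hx.1.2.1, fun h => ?_⟩
      rw [hd₁] at h
      rcases h with h | h
      · exact hx.1.2.2 h
      · exact h.1.2 ⟨x, hx, rfl⟩
    by_cases hN : P.nbhd G₁.edges v ⊆ P.nbhd G.edges v
    · have hN : P.nbhd G₁.edges v = P.nbhd G.edges v := hN.antisymm (P.nbhd_mono hG₁.1 v)
      refine .of_ask_until_edge (hBinf.image hinj.injOn) hBU ?_ ?_
      · intro G₂ hG₂ hE hd₂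
        have hv₂ : ¬ P.Large t G₂.edges v := by rwa [Large, hE, hN]
        have hS₂ : P.core v (P.nbhd G₂.edges v) = S := by rw [hE, hN]
        have hd₂' : ∀ x ∈ S, ∀ e ∈ H.edgeSet, x ∈ e → e ∈ G₂.determined := by
          intro x hx e he hxe
          rw [hd₂, hd₁]
          by_cases h : e ∈ (fun x => s(v, x)) '' B
          · exact Or.inr h
          · exact Or.inl (Or.inr ⟨⟨⟨x, hx, hxe⟩, h⟩, he⟩)
        obtain ⟨e, he, -⟩ := h_side G₂ (hG.trans (hG₁.trans hG₂)) hv₂ (by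
          rw [hd₂, hS₂]
          refine Set.union_subset hd₁S ?_
          rintro _ ⟨x, _, rfl⟩
          exact Or.inr ⟨v, P.self_mem_core _ _, Sym2.mem_mk_left _ _⟩)
        refine .of_terminated (terminated_of_not_large hv₂ fun e he x hx hxe => ?_) he
        rw [hS₂] at hx
        exact he.2 (hd₂' x hx e he.1 hxe)
      · rintro G₂ _ ⟨x, hx, rfl⟩ hG₂ hE hd₂ hinf₂
        have hvx : v ≠ x := (SimpleGraph.mem_edgeSet H |>.1 hx.1.2.1).ne
        refine ih G₂ (hG.trans (hG₁.trans hG₂))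
          (hgrow (hG₁.trans hG₂) (P.mem_nbhd_of_mem hvx ?_) hx.2)
          ⟨S, hSfin, core_nbhd_mono (hG₁.trans hG₂).1 v, ?_⟩ ?_
        · rw [hE]; exact Set.mem_insert _ _
        · refine hd₂.trans (Set.union_subset hd₁S ?_)
          rintro _ ⟨x, _, rfl⟩
          exact Or.inr ⟨v, P.self_mem_core _ _, Sym2.mem_mk_left _ _⟩
        · refine Set.Infinite.of_image (fun x => s(v, x)) (hinf₂.mono ?_)
          rintro _ ⟨⟨y, hy, rfl⟩, hyU⟩
          exact ⟨y, ⟨hy.1.1, hyU⟩, rfl⟩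
    · obtain ⟨y, hy, hy'⟩ := Set.not_subset.1 hN
      exact ih G₁ (hG.trans hG₁) (hgrow hG₁ hy hy')
        ⟨S, hSfin, core_nbhd_mono hG₁.1 v, hd₁S⟩
        (hBinf.mono fun x hx => ⟨hx.1.1, hBU ⟨x, hx, rfl⟩⟩)

/-! ### The strategy -/

/-- If all degrees of `H` are infinite, then Alice wins the game for the property that the sets
attached to all vertices have at least `t` elements. -/
theorem aliceHasWinningStrategy [Nonempty V] (hH : ∀ v, (H.neighborSet v).Infinite) :
    AliceHasWinningStrategy H (P.property t) := by
  apply AliceWinsFrom.aliceHasWinningStrategy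
  obtain ⟨v₀⟩ := ‹Nonempty V›
  have hinf : (Set.univ : Set V).Infinite := (hH v₀).mono (Set.subset_univ _)
  have hempty : (Pregraph.empty H).determined = ∅ := by simp [Pregraph.determined, Pregraph.empty]
  -- Alice makes `v₀` large. The core is finite until this is achieved, so that some pair avoids it.
  refine aliceWinsFrom_of_search (v := v₀) (hH v₀) (fun x hx => ⟨hx, by simp [hempty]⟩) ?_ ?_
  · intro G _ hv hdet
    have hS := finite_core hv
    obtain ⟨y, -, hy⟩ := (hinf.sdiff hS).nonempty
    obtain ⟨z, hyz, hz⟩ := ((hH y).sdiff hS).nonempty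
    have hnot : ∀ x ∈ P.core v₀ (P.nbhd G.edges v₀), x ∉ s(y, z) := by
      intro x hx hxe
      rcases Sym2.mem_iff.1 hxe with rfl | rfl
      exacts [hy hx, hz hx]
    refine ⟨s(y, z), ⟨hyz, fun h => ?_⟩, hnot⟩
    rcases hdet h with h | ⟨x, hx, hxe⟩
    · simp [hempty] at h
    · exact hnot x hx hxe
  rintro G₁ - hv₀ ⟨T, hT, hdet₁⟩ hW
  rw [hempty, Set.empty_union] at hdet₁
  -- `K` has `t + 1` elements, which is more than the core of a vertex that is not large can have.
  obtain ⟨K, hKW, hKcard⟩ := (hW.sdiff hT).exists_subset_card_eq (t + 1)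
  obtain ⟨w, hw⟩ : K.Nonempty := Finset.card_pos.1 (by omega)
  refine .of_ask_all {e | ∀ x ∈ K, x ∉ e} fun G₂ hG₂ hd₂ => ?_
  have hU₂ : ∀ e ∈ G₂.undetermined, ∃ k ∈ K, k ∈ e := by
    intro e he
    by_contra! hne
    exact he.2 (hd₂ ▸ Or.inr ⟨hne, he.1⟩)
  have hU₂' : ∀ k ∈ K, ∀ x, s(k, x) ∈ G₁.undetermined → s(k, x) ∈ G₂.undetermined := by
    intro k hk x hx
    refine ⟨hx.1, fun h => ?_⟩
    rw [hd₂] at h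
    rcases h with h | h
    · exact hx.2 h
    · exact h.1 k hk (Sym2.mem_mk_left _ _)
  have hv₀K : ∀ k ∈ K, s(v₀, k) ∈ G₂.undetermined := by
    intro k hk
    rw [Sym2.eq_swap]
    refine hU₂' k hk v₀ ?_
    rw [Sym2.eq_swap]
    exact (hKW hk).1.2
  have hv₀₂ : P.Large t G₂.edges v₀ := hv₀.mono hG₂.1
  by_cases hI : {x | x ∉ K ∧ ¬ P.Large t G₂.edges x}.Finite
  · -- Alice makes `w` large while some pair `s(w, x)` with a large `x` remains undetermined. As long
    -- as `w` is not large, its core misses `v₀` and some `k ∈ K`, so that `s(v₀, k)` is in reserve.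
    have hA : (((H.neighborSet w \ {x | x ∉ K ∧ ¬ P.Large t G₂.edges x}) \ K) \ T).Infinite :=
      (((hH w).sdiff hI).sdiff K.finite_toSet).sdiff hT
    refine aliceWinsFrom_of_search (v := w) hA ?_ ?_ ?_
    · rintro x ⟨⟨⟨hx, -⟩, -⟩, hxT⟩
      refine hU₂' w hw x ⟨hx, fun h => ?_⟩
      obtain ⟨y, hy, hye⟩ := hdet₁ h
      rcases Sym2.mem_iff.1 hye with rfl | rfl
      exacts [(hKW hw).2 hy, hxT hy]
    · intro G hG hwG hdet
      have hv₀c := notMem_core_of_large hwG (hv₀₂.mono hG.1)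
      obtain ⟨k, hk, hkc⟩ : ∃ k ∈ K, k ∉ P.core w (P.nbhd G.edges w) := by
        by_contra! hsub
        have h1 := (Set.encard_le_encard (s := (K : Set V)) hsub).trans (encard_core_le hwG)
        rw [Set.encard_coe_eq_coe_finsetCard, hKcard] at h1
        have : t + 1 ≤ t := by exact_mod_cast h1
        omega
      have hnot : ∀ x ∈ P.core w (P.nbhd G.edges w), x ∉ s(v₀, k) := by
        intro x hx hxe
        rcases Sym2.mem_iff.1 hxe with rfl | rfl
        exacts [hv₀c hx, hkc hx]
      refine ⟨s(v₀, k), ⟨(hv₀K k hk).1, fun h => ?_⟩, hnot⟩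
      rcases hdet h with h | ⟨x, hx, hxe⟩
      · exact (hv₀K k hk).2 h
      · exact hnot x hx hxe
    · rintro G hG hwG - hinf'
      obtain ⟨x, ⟨⟨⟨-, hxI⟩, hxK⟩, -⟩, hxU⟩ := hinf'.nonempty
      have hx : P.Large t G₂.edges x := by
        by_contra hx
        exact hxI ⟨hxK, hx⟩
      exact aliceWinsFrom_of_large_of_large hwG (hx.mono hG.1) hxU
  · -- Alice asks everything but the pairs `s(v₀, k)`. If no `k ∈ K` becomes large, then the sets
    -- attached to them are finite, and some vertex `u` that is not large lies outside of all of
    -- them. No new edge affects `u`, and neither do the remaining pairs.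
    refine .of_ask_all ((fun k => s(v₀, k)) '' K)ᶜ fun G₃ hG₃ hd₃ => ?_
    have hv₀K₃ : ∀ k ∈ K, s(v₀, k) ∈ G₃.undetermined := by
      intro k hk
      refine ⟨(hv₀K k hk).1, fun h => ?_⟩
      rw [hd₃] at h
      rcases h with h | h
      · exact (hv₀K k hk).2 h
      · exact h.1 ⟨k, hk, rfl⟩
    have hv₀₃ : P.Large t G₃.edges v₀ := hv₀₂.mono hG₃.1
    by_cases hK : ∃ k ∈ K, P.Large t G₃.edges k
    · obtain ⟨k, hk, hkL⟩ := hK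
      exact aliceWinsFrom_of_large_of_large hv₀₃ hkL (hv₀K₃ k hk)
    push Not at hK
    have hfin : (⋃ k ∈ K, P.nbhd G₃.edges k).Finite :=
      K.finite_toSet.biUnion fun k hk => finite_nbhd (hK k hk)
    obtain ⟨u, ⟨huK, hu⟩, huN⟩ := ((show Set.Infinite _ from hI).sdiff hfin).nonempty
    simp only [Set.mem_iUnion, not_exists] at huN
    have hKcore : ∀ k ∈ K, k ∉ P.core u (P.nbhd G₃.edges u) := by
      intro k hk hkc
      rcases P.mem_nbhd_of_mem_core hkc with rfl | h
      exacts [huK hk, huN k hk h]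
    have hnbhd : P.nbhd G₃.edges u = P.nbhd G₂.edges u := by
      refine P.nbhd_stable hG₃.1 fun e he he₂ x hx hxe => ?_
      have hx₃ := core_nbhd_mono hG₃.1 u hx
      obtain ⟨k, hk, hke⟩ := hU₂ e ⟨G₃.edges_subset_edgeSet he,
        fun h => he₂ (hG₃.mem_edges_of_mem_determined he h)⟩
      have hxk : x ≠ k := by
        rintro rfl
        exact hKcore x hk hx₃
      obtain rfl : e = s(x, k) := (Sym2.mem_and_mem_iff hxk).1 ⟨hxe, hke⟩
      exact huN k hk (P.mem_nbhd_of_adj_core hx₃ hxk he)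
    have hu₃ : ¬ P.Large t G₃.edges u := by rwa [Large, hnbhd]
    refine .of_terminated (terminated_of_not_large hu₃ fun e he x hx hxe => ?_) (hv₀K₃ w hw)
    obtain ⟨k, hk, rfl⟩ : e ∈ (fun k => s(v₀, k)) '' (K : Set V) := by
      by_contra hne
      exact he.2 (hd₃ ▸ Or.inr ⟨hne, he.1⟩)
    rcases Sym2.mem_iff.1 hxe with rfl | rfl
    exacts [notMem_core_of_large hu₃ hv₀₃ hx, hKcore _ hk hx]

end GrowingNbhd

/-! ### Degrees and components -/

/-- The neighborhoods of the vertices. -/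
def GrowingNbhd.neighbors (V : Type u) : GrowingNbhd V where
  nbhd E v := {x | v ≠ x ∧ s(v, x) ∈ E}
  core v _ := {v}
  nbhd_mono h v x hx := ⟨hx.1, h hx.2⟩
  core_mono _ _ _ _ := subset_rfl
  core_subset v N := by simp
  self_mem_core _ _ := rfl
  mem_nbhd_of_mem h h' := ⟨h, h'⟩
  nbhd_stable {E E' v} h h' := by
    ext x
    refine ⟨fun hx => ⟨hx.1, ?_⟩, fun hx => ⟨hx.1, h hx.2⟩⟩
    by_contra hxE
    exact h' _ hx.2 hxE v rfl (Sym2.mem_mk_left _ _)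
  nbhd_eq_of_mem_core := by rintro E v x rfl; rfl
  mem_nbhd_of_mem_core h := .inl h
  mem_nbhd_of_adj_core := by
    rintro E v x w rfl hne h
    exact ⟨hne.symm, Sym2.eq_swap ▸ h⟩

lemma SimpleGraph.Reachable.mem_of_adj_closed {V : Type u} {G : SimpleGraph V} {S : Set V}
    (hS : ∀ x ∈ S, ∀ y, G.Adj x y → y ∈ S) {v w : V} (h : G.Reachable v w) (hv : v ∈ S) :
    w ∈ S := by
  obtain ⟨p⟩ := h
  induction p with
  | nil => exact hv
  | cons hadj _ ih => exact ih (hS _ hv _ hadj)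

/-- The connected components of the vertices. -/
def GrowingNbhd.components (V : Type u) : GrowingNbhd V where
  nbhd E v := {x | (SimpleGraph.fromEdgeSet E).Reachable v x}
  core _ N := N
  nbhd_mono h v x hx := SimpleGraph.Reachable.mono (SimpleGraph.fromEdgeSet_mono h) hx
  core_mono _ _ _ h := h
  core_subset v N := Set.subset_insert v N
  self_mem_core _ _ := SimpleGraph.Reachable.refl _
  mem_nbhd_of_mem h h' :=
    SimpleGraph.Adj.reachable ((SimpleGraph.fromEdgeSet_adj _).2 ⟨h', h⟩)
  nbhd_stable {E E' v} h h' := by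
    refine Set.Subset.antisymm (fun x hx => ?_)
      fun x hx => SimpleGraph.Reachable.mono (SimpleGraph.fromEdgeSet_mono h) hx
    refine SimpleGraph.Reachable.mem_of_adj_closed (fun a ha b hab => ?_) hx
      (SimpleGraph.Reachable.refl _)
    obtain ⟨hab, hne⟩ := (SimpleGraph.fromEdgeSet_adj _).1 hab
    have habE : s(a, b) ∈ E := by
      by_contra hE
      exact h' _ hab hE a ha (Sym2.mem_mk_left _ _)
    exact SimpleGraph.Reachable.trans ha
      (SimpleGraph.Adj.reachable ((SimpleGraph.fromEdgeSet_adj _).2 ⟨habE, hne⟩))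
  nbhd_eq_of_mem_core {E v x} h := by
    ext y
    exact ⟨fun hy => SimpleGraph.Reachable.trans h hy,
      fun hy => SimpleGraph.Reachable.trans (SimpleGraph.Reachable.symm h) hy⟩
  mem_nbhd_of_mem_core h := .inr (SimpleGraph.Reachable.symm h)
  mem_nbhd_of_adj_core {E v x w} h hne h' := (SimpleGraph.Reachable.trans h
    (SimpleGraph.Adj.reachable ((SimpleGraph.fromEdgeSet_adj _).2 ⟨h', hne⟩))).symm

lemma GrowingNbhd.property_neighbors (n : ℕ) (V : Type u) :
    (neighbors V).property n = DegreesAtLeast n := by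
  funext F
  refine propext (forall_congr' fun v => ?_)
  have : (neighbors V).nbhd F.edgeSet v = F.neighborSet v := by
    ext x
    exact ⟨fun h => h.2, fun h => ⟨SimpleGraph.Adj.ne h, h⟩⟩
  rw [Large, this]

lemma GrowingNbhd.property_components (m : ℕ) (V : Type u) :
    (components V).property m = ComponentsAtLeast m := by
  funext F
  have (v : V) : (components V).nbhd F.edgeSet v = (F.connectedComponentMk v).supp := by
    ext x
    simp only [components, SimpleGraph.fromEdgeSet_edgeSet, Set.mem_ofPred_eq,
      SimpleGraph.ConnectedComponent.mem_supp_iff, SimpleGraph.ConnectedComponent.eq]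
    exact SimpleGraph.reachable_comm
  refine propext ⟨fun h c => ?_, fun h v => ?_⟩
  · induction c using SimpleGraph.ConnectedComponent.ind with
    | _ v => rw [← this]; exact h v
  · rw [Large, this]; exact h _

/-- The property `D_n` is not elusive in a graph all of whose degrees are infinite. -/
theorem aliceHasWinningStrategy_degreesAtLeast {V : Type u} [Nonempty V] {H : SimpleGraph V}
    (hH : ∀ v, (H.neighborSet v).Infinite) (n : ℕ) :
    AliceHasWinningStrategy H (DegreesAtLeast n) :=
  GrowingNbhd.property_neighbors n V ▸ GrowingNbhd.aliceHasWinningStrategy hH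

/-- The property `C_m` is not elusive in a graph all of whose degrees are infinite. -/
theorem aliceHasWinningStrategy_componentsAtLeast {V : Type u} [Nonempty V] {H : SimpleGraph V}
    (hH : ∀ v, (H.neighborSet v).Infinite) (m : ℕ) :
    AliceHasWinningStrategy H (ComponentsAtLeast m) :=
  GrowingNbhd.property_components m V ▸ GrowingNbhd.aliceHasWinningStrategy hH

/-! ### The host graphs have infinite degrees -/

lemma infinite_toType_ord {κ : Cardinal.{u}} (hκ : Cardinal.aleph0 ≤ κ) :
    Infinite κ.ord.ToType := by
  rwa [← Cardinal.aleph0_le_mk_iff, Cardinal.mk_toType, Cardinal.card_ord]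

lemma infinite_neighborSet_completeGraphCard {κ : Cardinal.{u}} (hκ : Cardinal.aleph0 ≤ κ)
    (v : κ.ord.ToType) : ((completeGraphCard κ).neighborSet v).Infinite := by
  have := infinite_toType_ord hκ
  refine (Set.infinite_univ.sdiff (Set.finite_singleton v)).mono fun x hx => ?_
  exact fun h => hx.2 h.symm

lemma infinite_neighborSet_turanGraphCard {κ : Cardinal.{u}} (hκ : Cardinal.aleph0 ≤ κ) {k : ℕ}
    (hk : 2 ≤ k) (v : κ.ord.ToType × Fin k) : ((turanGraphCard κ k).neighborSet v).Infinite := by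
  have := infinite_toType_ord hκ
  have : Nontrivial (Fin k) := Fin.nontrivial_iff_two_le.2 hk
  obtain ⟨j, hj⟩ := exists_ne v.2
  refine (Set.infinite_range_of_injective (Prod.mk_left_injective j)).mono ?_
  rintro _ ⟨a, rfl⟩
  exact hj.symm

lemma infinite_neighborSet_cantorGraph (s : List Bool) :
    (cantorGraph.neighborSet s).Infinite := by
  refine (Set.infinite_range_of_injective
    (f := fun n : ℕ => s ++ List.replicate (n + 1) true) fun m n h => ?_).mono ?_
  · simpa using congrArg List.length h
  · rintro _ ⟨n, rfl⟩
    exact ⟨fun h => by simpa using congrArg List.length h, .inl (List.prefix_append _ _)⟩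

theorem mainTheorem1 :
    (∀ n : ℕ, 1 ≤ n →
      (∀ κ : Cardinal.{u}, Cardinal.aleph0 ≤ κ →
        AliceHasWinningStrategy (completeGraphCard κ) (DegreesAtLeast n) ∧
        ¬ IsElusive (completeGraphCard κ) (DegreesAtLeast n)) ∧
      (∀ κ : Cardinal.{u}, Cardinal.aleph0 ≤ κ → ∀ k : ℕ, 2 ≤ k →
        AliceHasWinningStrategy (turanGraphCard κ k) (DegreesAtLeast n) ∧
        ¬ IsElusive (turanGraphCard κ k) (DegreesAtLeast n)) ∧
      (AliceHasWinningStrategy cantorGraph (DegreesAtLeast n) ∧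
        ¬ IsElusive cantorGraph (DegreesAtLeast n))) ∧
    (∀ m : ℕ, 2 ≤ m →
      (∀ κ : Cardinal.{u}, Cardinal.aleph0 ≤ κ →
        AliceHasWinningStrategy (completeGraphCard κ) (ComponentsAtLeast m) ∧
        ¬ IsElusive (completeGraphCard κ) (ComponentsAtLeast m)) ∧
      (∀ κ : Cardinal.{u}, Cardinal.aleph0 ≤ κ → ∀ k : ℕ, 2 ≤ k →
        AliceHasWinningStrategy (turanGraphCard κ k) (ComponentsAtLeast m) ∧
        ¬ IsElusive (turanGraphCard κ k) (ComponentsAtLeast m)) ∧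
      (AliceHasWinningStrategy cantorGraph (ComponentsAtLeast m) ∧
        ¬ IsElusive cantorGraph (ComponentsAtLeast m))) := by
  refine ⟨fun n _ => ⟨fun κ hκ => ?_, fun κ hκ k hk => ?_, ?_⟩,
    fun m _ => ⟨fun κ hκ => ?_, fun κ hκ k hk => ?_, ?_⟩⟩
  · have := infinite_toType_ord hκ
    have h := aliceHasWinningStrategy_degreesAtLeast
      (infinite_neighborSet_completeGraphCard hκ) n
    exact ⟨h, not_not_intro h⟩
  · have := infinite_toType_ord hκ
    have : NeZero k := ⟨by omega⟩
    have h := aliceHasWinningStrategy_degreesAtLeast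
      (infinite_neighborSet_turanGraphCard hκ hk) n
    exact ⟨h, not_not_intro h⟩
  · have h := aliceHasWinningStrategy_degreesAtLeast infinite_neighborSet_cantorGraph n
    exact ⟨h, not_not_intro h⟩
  · have := infinite_toType_ord hκ
    have h := aliceHasWinningStrategy_componentsAtLeast
      (infinite_neighborSet_completeGraphCard hκ) m
    exact ⟨h, not_not_intro h⟩
  · have := infinite_toType_ord hκ
    have : NeZero k := ⟨by omega⟩
    have h := aliceHasWinningStrategy_componentsAtLeast
      (infinite_neighborSet_turanGraphCard hκ hk) m
    exact ⟨h, not_not_intro h⟩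
  · have h := aliceHasWinningStrategy_componentsAtLeast infinite_neighborSet_cantorGraph m
    exact ⟨h, not_not_intro h⟩
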